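/- An occurrence of a formula $f$ (a finite list of words over the variables $A_0,A_1,A_2,\dots$, called its fragments) in an infinite word $w$ over an alphabet $\Sigma$ is a non-erasing morphism $h$ from words over the variables to words over $\Sigma$ such that the $h$-image of every fragment of $f$ is a factor of $w$; $w$ avoids $f$ if it contains no occurrence of $f$. The avoidability index $\lambda(f)\in\mathbb{N}\cup\{\infty\}$ is the size of the smallest alphabet over which some infinite word avoids $f$ ($\lambda(f)=\infty$ if there is no such finite alphabet). For $t\ge 1$, the circular formula $C_t$ is the formula over the variables $A_0,\dots,A_{t-1}$ whose fragments are the $t$ words $A_iA_{i+1}\cdots A_{i+t}$, $0\le i<t$, with indices taken modulo $t$; for example $C_3=ABCA.BCAB.CABC$. Then $\lambda(C_3)=3$, and $\lambda(C_i)=2$ for every $i\ge 4$. -/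

import Mathlib

/-- A formula over the variable alphabet `{A₀, A₁, A₂, …}` (the variable `Aᵢ` is the letter `i`),
given as the list of its fragments, each of which is a finite word of variables. -/
abbrev Formula : Type := List (FreeMonoid ℕ)

/-- The finite word `u` is a factor of the (right-)infinite word `w = w 0, w 1, w 2, …`. -/
def IsFactor {α : Type*} (u : FreeMonoid α) (w : ℕ → α) : Prop :=
  ∃ n : ℕ, u.toList = (List.range u.length).map (fun k => w (n + k))

/-- A morphism of free monoids is non-erasing if the image of every letter is a non-empty word. -/
def NonErasing {β α : Type*} (h : FreeMonoid β →* FreeMonoid α) : Prop :=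
  ∀ x : β, h (FreeMonoid.of x) ≠ 1

/-- `h` is an occurrence of the formula `f` in the infinite word `w`: it is non-erasing and
the image of every fragment of `f` is a factor of `w`. -/
def IsOccurrence {α : Type*} (h : FreeMonoid ℕ →* FreeMonoid α) (f : Formula) (w : ℕ → α) :
    Prop :=
  NonErasing h ∧ ∀ p ∈ f, IsFactor (h p) w

/-- The infinite word `w` avoids the formula `f`: it contains no occurrence of `f`. -/
def Avoids {α : Type*} (w : ℕ → α) (f : Formula) : Prop :=
  ¬ ∃ h : FreeMonoid ℕ →* FreeMonoid α, IsOccurrence h f w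

/-- The avoidability index `λ(f)`: the least size of an alphabet over which some infinite word
avoids `f`, and `⊤` (that is, `∞`) if there is no such finite alphabet. -/
noncomputable def avoidabilityIndex (f : Formula) : ℕ∞ :=
  sInf {N : ℕ∞ | ∃ n : ℕ, N = n ∧ ∃ w : ℕ → Fin n, Avoids w f}

/-- The circular formula `C_t` (`t ≥ 1`): its `t` fragments are the words
`A_i A_{i+1} … A_{i+t}`, `0 ≤ i < t`, with indices taken modulo `t`. -/
def circularFormula (t : ℕ) : Formula :=
  (List.range t).map fun i =>
    FreeMonoid.ofList ((List.range (t + 1)).map fun j => (i + j) % t)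

/-!
The statement splits into avoiding words (upper bounds) and a finite search (lower bound for `C₃`).

*Circles.* If `h` is an occurrence of `C_t` in `w`, put `u = h(A₀ ⋯ A_{t-1})` and `p = |u| ≥ t`. The
fragment starting with `A_i` is mapped to the factor of the periodic word `u^ω` that has length
`p + |h(A_i)|` and starts where the block `h(A_i)` does. The factors of length `p + 1` of `u^ω` are
covered by these images, so all of them occur in `w` (`exists_containsCircle_of_isOccurrence`); call
this a circle of length `p` in `w` (`ContainsCircle`). Hence a word without circles of length
`p ≥ t` avoids `C_i` for all `i ≥ t` at once.

*Desubstitution.* Let `u` be the image of `v` under a `q`-uniform morphism for which a window of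
length `L` in `u` determines its offset modulo `q`. A circle of length `p ≥ L` in `u` then forces
`q ∣ p` and comes from a circle of length `p / q` in `v` (`ContainsCircle.desubstitute`). So only
circles of length less than `L` have to be excluded by hand. The fixed point `quatWord` of the
`7`-uniform morphism `a ↦ a + 0130210` over `ℤ/4` has no circle at all, since every circle would
descend to a shorter one; its image `ternWord` under a `3`-uniform morphism has none of length at
least `3`, and its binary image `binWord` under an `8`-uniform morphism has none of length at
least `4`.

*Lower bound.* Every infinite binary word contains an occurrence of `C₃` (`containsTriple`). A square
`uu` with `|u| ≥ 3` is already such an occurrence. With these squares and the `16` occurrences listed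
in `smallTriples`, the tree of all binary words is exhausted by a search. The search is kept small by
excluding in turn the factors in `excludedFactors`: all words starting with the first of them die
out, hence, as shifts of avoiding words are avoiding, that factor cannot occur anywhere and may be
treated as dead afterwards.

The finite checks are evaluated in the kernel, with words coded as natural numbers.
-/

/-! ### Factors of infinite words -/

/-- The factor of length `ℓ` of the infinite word `w` at position `i`. -/
def factor {α : Type*} (w : ℕ → α) (i ℓ : ℕ) : List α := (List.range ℓ).map fun k => w (i + k)

@[simp] theorem length_factor {α : Type*} (w : ℕ → α) (i ℓ : ℕ) : (factor w i ℓ).length = ℓ := by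
  simp [factor]

theorem factor_succ {α : Type*} (w : ℕ → α) (i ℓ : ℕ) :
    factor w i (ℓ + 1) = factor w i ℓ ++ [w (i + ℓ)] := by
  simp [factor, List.range_succ]

theorem factor_add {α : Type*} (w : ℕ → α) (i m n : ℕ) :
    factor w i (m + n) = factor w i m ++ factor w (i + m) n := by
  simp [factor, List.range_add, Function.comp_def, add_assoc]

theorem factor_shift {α : Type*} (w : ℕ → α) (N i ℓ : ℕ) :
    factor (fun n => w (N + n)) i ℓ = factor w (N + i) ℓ := by
  simp [factor, add_assoc]

theorem isFactor_iff {α : Type*} {u : FreeMonoid α} {w : ℕ → α} :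
    IsFactor u w ↔ ∃ i ℓ, u.toList = factor w i ℓ := by
  constructor
  · rintro ⟨n, hn⟩
    exact ⟨n, _, hn⟩
  · rintro ⟨i, ℓ, h⟩
    have hl : u.length = ℓ := by
      exact (congrArg List.length h).trans (length_factor w i ℓ)
    exact ⟨i, by rw [h, hl]; rfl⟩

/-- `w` contains an occurrence of `C₃`: the images of the three variables are the non-empty words
`a`, `b`, `c`. -/
def ContainsTriple {α : Type*} (w : ℕ → α) : Prop :=
  ∃ a b c : List α, a ≠ [] ∧ b ≠ [] ∧ c ≠ [] ∧ (∃ i ℓ, a ++ b ++ c ++ a = factor w i ℓ) ∧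
    (∃ i ℓ, b ++ c ++ a ++ b = factor w i ℓ) ∧ ∃ i ℓ, c ++ a ++ b ++ c = factor w i ℓ

theorem ContainsTriple.of_shift {α : Type*} {w : ℕ → α} (N : ℕ)
    (h : ContainsTriple fun n => w (N + n)) : ContainsTriple w := by
  obtain ⟨a, b, c, ha, hb, hc, ⟨i, ℓ, h₁⟩, ⟨j, m, h₂⟩, ⟨k, n, h₃⟩⟩ := h
  rw [factor_shift] at h₁ h₂ h₃
  exact ⟨a, b, c, ha, hb, hc, ⟨_, _, h₁⟩, ⟨_, _, h₂⟩, ⟨_, _, h₃⟩⟩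

/-- A square `uu` with `|u| ≥ 3` contains an occurrence of `C₃`: cut `u` into its first letter, its
second letter and the rest. -/
theorem containsTriple_of_square {α : Type*} {w : ℕ → α} {i p : ℕ} (hp : 3 ≤ p)
    (h : factor w i p = factor w (i + p) p) : ContainsTriple w := by
  obtain ⟨r, rfl⟩ := Nat.exists_eq_add_of_le (show 2 ≤ p by omega)
  have e : ∀ j, factor w j (2 + r) = factor w j 1 ++ factor w (j + 1) 1 ++ factor w (j + 2) r := by
    intro j
    rw [show 2 + r = 1 + 1 + r by ring, factor_add, factor_add]
  rw [e, e] at h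
  obtain ⟨h, h₃⟩ := List.append_inj h (by simp)
  obtain ⟨h₁, h₂⟩ := List.append_inj h (by simp)
  have ne : ∀ j ℓ, 1 ≤ ℓ → factor w j ℓ ≠ [] := fun j ℓ hℓ h => by
    have := congrArg List.length h
    rw [length_factor, List.length_nil] at this
    omega
  refine ⟨factor w i 1, factor w (i + 1) 1, factor w (i + 2) r, ne _ 1 le_rfl, ne _ 1 le_rfl,
    ne _ r (by omega), ⟨i, 1 + 1 + r + 1, ?_⟩, ⟨i + 1, 1 + r + 1 + 1, ?_⟩,
    ⟨i + 2, r + 1 + 1 + r, ?_⟩⟩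
  · rw [factor_add, factor_add, factor_add, show i + (1 + 1 + r) = i + (2 + r) by omega, ← h₁]
  · rw [factor_add, factor_add, factor_add, show i + 1 + (1 + r) = i + (2 + r) by omega,
      show i + 1 + (1 + r + 1) = i + (2 + r) + 1 by omega, ← h₁, ← h₂]
  · rw [factor_add, factor_add, factor_add, show i + 2 + r = i + (2 + r) by omega,
      show i + 2 + (r + 1) = i + (2 + r) + 1 by omega,
      show i + 2 + (r + 1 + 1) = i + (2 + r) + 2 by omega, ← h₁, ← h₂, ← h₃]

/-! ### A search over binary words -/

/-- The word `l` over `{0, 1}` read in binary behind a leading digit `1`, which makes the code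
injective on words of all lengths. -/
def wordCode (l : List (Fin 2)) : ℕ := l.foldl (fun c b => 2 * c + b.val) 1

/-- The code of the factor of length `ℓ` of `w` at position `i`. -/
def factorCode (w : ℕ → Fin 2) (i : ℕ) : ℕ → ℕ
  | 0 => 1
  | ℓ + 1 => 2 * factorCode w i ℓ + w (i + ℓ)

/-- `f n`, arranged so that the kernel evaluates `n` to a numeral before passing it on. -/
def evalThen {β : Type} (n : ℕ) (f : ℕ → β) : β := Nat.casesOn n (f 0) (fun m => f (m + 1))

/-- Adds to the set `S` of word codes (a natural number used as a bit set) the codes of those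
suffixes of the word with code `c` whose lengths are in the given increasing list. The remainder
`c % 2 ^ ℓ` is the suffix of length `ℓ` only if the word has at least `ℓ` letters, that is, if
`2 ^ ℓ ≤ c`. Powers, comparisons and bit operations are written here and below without the notation
classes, which the kernel would have to unfold. -/
def addSuffixes (c S : ℕ) : List ℕ → ℕ
  | [] => S
  | ℓ :: ls => bif Nat.ble (Nat.pow 2 ℓ) c then
      Nat.lor (addSuffixes c S ls) (Nat.pow 2 (Nat.pow 2 ℓ + c % Nat.pow 2 ℓ)) else S

/-- The word with code `c` ends in a square of one of the given periods, listed increasingly. -/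
def suffixSquare (c : ℕ) : List ℕ → Bool
  | [] => false
  | p :: ps => bif Nat.ble (Nat.pow 4 p) c then
      bif Nat.beq (c % Nat.pow 2 p) (c.shiftRight p % Nat.pow 2 p) then true else suffixSquare c ps
    else false

/-- The bit set `S` includes one of the bit sets in the list. -/
def containsOne (S : ℕ) : List ℕ → Bool
  | [] => false
  | m :: D => bif Nat.beq (Nat.land S m) m then true else containsOne S D

/-- Passes to `f` the state of the search after appending the letter `b`: the code of the current
word, and the set of the codes of its factors of length at most `10` (the length of the longest word
that matters to the search). -/
def appendThen {β : Type} (b : ℕ) (c S : ℕ) (f : ℕ → ℕ → β) : β :=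
  evalThen (2 * c + b) fun c' => evalThen (addSuffixes c' S [1, 2, 3, 4, 5, 6, 7, 8, 9, 10]) (f c')

/-- The step of `allDead` after a letter has been appended: the word is dead if it contains all
the words of one of the sets in `D` or ends in a long square; otherwise `rest` decides. -/
def deadOr (D : List ℕ) (rest : ℕ → ℕ → Bool) (c S : ℕ) : Bool :=
  bif containsOne S D then true else
    bif suffixSquare c [3, 4, 5, 6, 7, 8, 9, 10, 11, 12, 13, 14, 15, 16, 17, 18]
    then true else rest c S

/-- Every extension by `k` letters of the word with code `c` and set of factors `S` passes through
a dead word. -/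
def allDead (D : List ℕ) : ℕ → ℕ → ℕ → Bool
  | 0, _, _ => false
  | k + 1, c, S => appendThen 0 c S (deadOr D (allDead D k)) &&
      appendThen 1 c S (deadOr D (allDead D k))

/-- The same after appending the letters of a given word; `60` exceeds the depth of every search
tree that is needed. -/
def allDeadFrom (D : List ℕ) : List (Fin 2) → ℕ → ℕ → Bool
  | [], c, S => allDead D 60 c S
  | b :: z, c, S => appendThen b c S (allDeadFrom D z)

/-- Successively shows that the given words cannot be factors, making each of them dead for the
searches that follow, and finally that no infinite word is left. -/
def allDeadChain : List (List (Fin 2)) → List ℕ → Bool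
  | [], D => allDead D 60 1 0
  | z :: zs, D => allDeadFrom D z 1 0 &&
      evalThen (2 ^ wordCode z) fun m => allDeadChain zs (m :: D)

/-- `f` applied to the reverse of `ms` followed by `acc`, after evaluating the elements of `ms` as in
`evalThen`. -/
def evalListThen {β : Type} : List ℕ → List ℕ → (List ℕ → β) → β
  | [], acc, f => f acc
  | m :: ms, acc, f => evalThen m fun m => evalListThen ms (m :: acc) f

/-- The set of the codes of the three fragments of `C₃` for the images `t.1`, `t.2.1`, `t.2.2` of
the variables. -/
def tripleMask (t : List (Fin 2) × List (Fin 2) × List (Fin 2)) : ℕ :=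
  Nat.lor (2 ^ wordCode (t.1 ++ t.2.1 ++ t.2.2 ++ t.1))
    (Nat.lor (2 ^ wordCode (t.2.1 ++ t.2.2 ++ t.1 ++ t.2.1))
      (2 ^ wordCode (t.2.2 ++ t.1 ++ t.2.1 ++ t.2.2)))

/-- Occurrences of `C₃` which, together with the squares of periods `3` to `18`, cannot be avoided by
an infinite binary word. -/
def smallTriples : List (List (Fin 2) × List (Fin 2) × List (Fin 2)) :=
  [([0], [1, 0], [1, 1, 1]), ([0, 0], [0, 1], [1, 1]), ([0], [0, 0, 1, 1], [1]),
   ([0], [0, 0, 1], [0, 1]), ([0], [0, 0, 1], [1]), ([0, 0], [0, 1], [1]),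
   ([0], [1], [1, 1, 0]), ([0], [0, 1, 1], [1]), ([0], [0], [0, 1]), ([0, 0], [1], [1]),
   ([0], [1], [0, 1]), ([0], [1, 0], [1]), ([0], [1], [1]), ([0], [0], [1]),
   ([1], [1], [1]), ([0], [0], [0])]

/-- Words to be excluded as factors, in this order. The choice only affects the size of the
search; it was made greedily so as to leave few words to be visited. -/
def excludedFactors : List (List (Fin 2)) :=
  [[0, 0, 0, 1, 0, 1, 0], [1, 0, 0, 0, 1, 1, 0], [1, 0, 0, 0, 1, 0, 1, 1, 1],
   [0, 0, 1, 1, 1, 0, 1], [0, 1, 1, 1, 0, 0], [1, 0, 0], [0, 1], [0]]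

theorem factorCode_eq (w : ℕ → Fin 2) (i ℓ : ℕ) : factorCode w i ℓ = wordCode (factor w i ℓ) := by
  induction ℓ with
  | zero => rfl
  | succ ℓ ih => rw [factor_succ, wordCode, List.foldl_append, factorCode, ih]; rfl

theorem one_le_wordCode (l : List (Fin 2)) : 1 ≤ wordCode l := by
  induction l using List.reverseRecOn with
  | nil => exact le_rfl
  | append_singleton l b ih =>
    simp only [wordCode, List.foldl_append, List.foldl_cons, List.foldl_nil] at ih ⊢
    omega

theorem wordCode_injective : Function.Injective wordCode := by
  intro l
  induction l using List.reverseRecOn with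
  | nil =>
    intro l' h
    induction l' using List.reverseRecOn with
    | nil => rfl
    | append_singleton l' b _ =>
      have := one_le_wordCode l'
      simp only [wordCode, List.foldl_append, List.foldl_cons, List.foldl_nil] at h this
      omega
  | append_singleton l a ih =>
    intro l' h
    induction l' using List.reverseRecOn with
    | nil =>
      have := one_le_wordCode l
      simp only [wordCode, List.foldl_append, List.foldl_cons, List.foldl_nil] at h this
      omega
    | append_singleton l' b _ =>
      simp only [wordCode, List.foldl_append, List.foldl_cons, List.foldl_nil] at h
      have ha := a.isLt
      have hb := b.isLt
      have hab : a = b := Fin.ext (by omega)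
      have : wordCode l = wordCode l' := by
        simp only [wordCode]
        omega
      rw [ih this, hab]

theorem two_pow_le_factorCode (w : ℕ → Fin 2) (i ℓ : ℕ) : 2 ^ ℓ ≤ factorCode w i ℓ := by
  induction ℓ with
  | zero => exact le_rfl
  | succ ℓ ih => rw [factorCode, pow_succ]; omega

theorem factorCode_lt (w : ℕ → Fin 2) (i ℓ : ℕ) : factorCode w i ℓ < 2 ^ (ℓ + 1) := by
  induction ℓ with
  | zero => simp [factorCode]
  | succ ℓ ih => have := (w (i + ℓ)).isLt; rw [factorCode, pow_succ]; omega

/-- Appending `ℓ` letters shifts the code of a prefix by `ℓ` binary digits. -/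
theorem factorCode_add (w : ℕ → Fin 2) (i m ℓ : ℕ) :
    factorCode w i (m + ℓ) + 2 ^ ℓ = factorCode w i m * 2 ^ ℓ + factorCode w (i + m) ℓ := by
  induction ℓ with
  | zero => simp [factorCode]
  | succ ℓ ih =>
    rw [← add_assoc, factorCode, factorCode, pow_succ, ← add_assoc]
    linarith

theorem le_of_two_pow_le_factorCode {w : ℕ → Fin 2} {i n ℓ : ℕ} (h : 2 ^ ℓ ≤ factorCode w i n) :
    ℓ ≤ n :=
  Nat.lt_succ_iff.1 ((Nat.pow_lt_pow_iff_right (by norm_num)).1 (h.trans_lt (factorCode_lt w i n)))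

theorem factorCode_mod (w : ℕ → Fin 2) (i m ℓ : ℕ) :
    2 ^ ℓ + factorCode w i (m + ℓ) % 2 ^ ℓ = factorCode w (i + m) ℓ := by
  have h := factorCode_add w i m ℓ
  have h₁ := two_pow_le_factorCode w (i + m) ℓ
  have h₂ := factorCode_lt w (i + m) ℓ
  obtain ⟨d, hd⟩ := Nat.exists_eq_add_of_le h₁
  rw [hd, pow_succ] at h₂
  have : factorCode w i (m + ℓ) = d + 2 ^ ℓ * factorCode w i m := by rw [hd] at h; linarith
  rw [hd, this, Nat.add_mul_mod_self_left, Nat.mod_eq_of_lt (by omega)]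

theorem factorCode_shiftRight (w : ℕ → Fin 2) (i m ℓ : ℕ) :
    (factorCode w i (m + ℓ)).shiftRight ℓ = factorCode w i m := by
  have h := factorCode_add w i m ℓ
  have h₁ := two_pow_le_factorCode w (i + m) ℓ
  have h₂ := factorCode_lt w (i + m) ℓ
  obtain ⟨d, hd⟩ := Nat.exists_eq_add_of_le h₁
  rw [hd, pow_succ] at h₂
  have : factorCode w i (m + ℓ) = d + 2 ^ ℓ * factorCode w i m := by rw [hd] at h; linarith
  change factorCode w i (m + ℓ) >>> ℓ = _
  rw [Nat.shiftRight_eq_div_pow, this, Nat.add_mul_div_left _ _ (by positivity),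
    Nat.div_eq_of_lt (by omega), zero_add]

/-- Every element of the bit set `S` is the code of a factor of `w`. -/
def RecordsFactors (w : ℕ → Fin 2) (S : ℕ) : Prop :=
  ∀ m, S.testBit m = true → ∃ i ℓ, m = factorCode w i ℓ

theorem RecordsFactors.addSuffixes {w : ℕ → Fin 2} {S : ℕ} (hS : RecordsFactors w S) (n : ℕ)
    (ls : List ℕ) : RecordsFactors w (addSuffixes (factorCode w 0 n) S ls) := by
  induction ls with
  | nil => exact hS
  | cons ℓ ls ih =>
    rw [_root_.addSuffixes]
    cases h : Nat.ble (Nat.pow 2 ℓ) (factorCode w 0 n) with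
    | false => exact hS
    | true =>
      obtain ⟨m, rfl⟩ := Nat.exists_eq_add_of_le'
        (le_of_two_pow_le_factorCode (Nat.le_of_ble_eq_true h))
      intro j hj
      change (_ ||| _ : ℕ).testBit j = true at hj
      rw [Nat.testBit_or, Bool.or_eq_true] at hj
      rcases hj with hj | hj
      · exact ih j hj
      · change (2 ^ (2 ^ ℓ + factorCode w 0 (m + ℓ) % 2 ^ ℓ)).testBit j = true at hj
        rw [factorCode_mod, Nat.testBit_two_pow] at hj
        exact ⟨0 + m, ℓ, (of_decide_eq_true hj).symm⟩

theorem containsTriple_of_suffixSquare {w : ℕ → Fin 2} {n : ℕ} {ps : List ℕ}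
    (h : suffixSquare (factorCode w 0 n) ps = true) (hps : ∀ p ∈ ps, 3 ≤ p) :
    ContainsTriple w := by
  induction ps with
  | nil => simp [suffixSquare] at h
  | cons p ps ih =>
    rw [suffixSquare] at h
    cases h₁ : Nat.ble (Nat.pow 4 p) (factorCode w 0 n) with
    | false =>
      rw [h₁, cond_false] at h
      exact absurd h (by decide)
    | true =>
      rw [h₁, cond_true] at h
      cases h₂ : Nat.beq (factorCode w 0 n % Nat.pow 2 p)
        ((factorCode w 0 n).shiftRight p % Nat.pow 2 p) with
      | false =>
        rw [h₂, cond_false] at h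
        exact ih h fun q hq => hps q (List.mem_cons_of_mem _ hq)
      | true =>
        have h₁ : 2 ^ (p + p) ≤ factorCode w 0 n := by
          rw [← two_mul, pow_mul]
          exact Nat.le_of_ble_eq_true h₁
        obtain ⟨m, rfl⟩ := Nat.exists_eq_add_of_le' (le_of_two_pow_le_factorCode h₁)
        have h₂ := Nat.eq_of_beq_eq_true h₂
        rw [← add_assoc, factorCode_shiftRight] at h₂
        have h₃ : factorCode w (0 + m) p = factorCode w (0 + (m + p)) p := by
          rw [← factorCode_mod, ← factorCode_mod]
          exact congrArg _ h₂.symm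
        rw [factorCode_eq, factorCode_eq, ← add_assoc] at h₃
        exact containsTriple_of_square (hps p List.mem_cons_self) (wordCode_injective h₃)

/-- Every infinite binary word that has all the words in the bit set `m` as factors contains an
occurrence of `C₃`. -/
def Unavoided (m : ℕ) : Prop := ∀ w : ℕ → Fin 2, RecordsFactors w m → ContainsTriple w

theorem containsTriple_of_containsOne {w : ℕ → Fin 2} {S : ℕ} {D : List ℕ}
    (h : containsOne S D = true) (hD : ∀ m ∈ D, Unavoided m) (hS : RecordsFactors w S) :
    ContainsTriple w := by
  induction D with
  | nil => simp [containsOne] at h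
  | cons m D ih =>
    rw [containsOne] at h
    cases h₁ : Nat.beq (Nat.land S m) m with
    | false =>
      rw [h₁, cond_false] at h
      exact ih h fun q hq => hD q (List.mem_cons_of_mem _ hq)
    | true =>
      refine hD m List.mem_cons_self w fun j hj => hS j ?_
      have h₂ : S &&& m = m := Nat.eq_of_beq_eq_true h₁
      rw [← h₂, Nat.testBit_and, Bool.and_eq_true] at hj
      exact hj.1

theorem evalThen_eq {β : Type} (n : ℕ) (f : ℕ → β) : evalThen n f = f n := by
  cases n <;> rfl

theorem containsTriple_of_allDead {w : ℕ → Fin 2} {D : List ℕ} (hD : ∀ m ∈ D, Unavoided m)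
    {k n S : ℕ} (h : allDead D k (factorCode w 0 n) S = true) (hS : RecordsFactors w S) :
    ContainsTriple w := by
  induction k generalizing n S with
  | zero => simp [allDead] at h
  | succ k ih =>
    have key : appendThen (w n) (factorCode w 0 n) S (deadOr D (allDead D k)) = true := by
      rw [allDead, Bool.and_eq_true] at h
      generalize w n = b at *
      fin_cases b
      · exact h.1
      · exact h.2
    rw [appendThen, evalThen_eq, evalThen_eq] at key
    have e : 2 * factorCode w 0 n + w n = factorCode w 0 (n + 1) := by rw [factorCode, zero_add]
    rw [e, deadOr] at key
    have hS' := hS.addSuffixes (n + 1) [1, 2, 3, 4, 5, 6, 7, 8, 9, 10]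
    rw [Bool.cond_eq_ite, Bool.cond_eq_ite] at key
    split_ifs at key with h₁ h₂
    · exact containsTriple_of_containsOne h₁ hD hS'
    · exact containsTriple_of_suffixSquare h₂ (by decide)
    · exact ih key hS'

theorem containsTriple_of_allDeadFrom {w : ℕ → Fin 2} {D : List ℕ} (hD : ∀ m ∈ D, Unavoided m)
    {z : List (Fin 2)} {n S : ℕ} (h : allDeadFrom D z (factorCode w 0 n) S = true)
    (hz : z = factor w n z.length) (hS : RecordsFactors w S) : ContainsTriple w := by
  induction z generalizing n S with
  | nil => exact containsTriple_of_allDead hD h hS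
  | cons b z ih =>
    rw [List.length_cons, add_comm, factor_add] at hz
    have hb : b = w n ∧ z = factor w (n + 1) z.length := by
      simpa [factor] using hz
    rw [allDeadFrom, appendThen, evalThen_eq, evalThen_eq, hb.1] at h
    have e : 2 * factorCode w 0 n + w n = factorCode w 0 (n + 1) := by rw [factorCode, zero_add]
    rw [e] at h
    exact ih h hb.2 (hS.addSuffixes _ _)

theorem recordsFactors_zero (w : ℕ → Fin 2) : RecordsFactors w 0 := by
  intro m hm
  simp at hm

theorem containsTriple_of_allDeadChain (w : ℕ → Fin 2) {zs : List (List (Fin 2))} {D : List ℕ}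
    (hD : ∀ m ∈ D, Unavoided m) (h : allDeadChain zs D = true) : ContainsTriple w := by
  induction zs generalizing D with
  | nil => exact containsTriple_of_allDead (n := 0) hD h (recordsFactors_zero w)
  | cons z zs ih =>
    rw [allDeadChain, Bool.and_eq_true, evalThen_eq] at h
    refine ih (fun m hm => ?_) h.2
    rcases List.mem_cons.1 hm with rfl | hm
    · intro w hw
      obtain ⟨i, ℓ, hi⟩ := hw (wordCode z) (by simp)
      rw [factorCode_eq] at hi
      have hz := wordCode_injective hi
      refine ContainsTriple.of_shift i
        (containsTriple_of_allDeadFrom hD (n := 0) h.1 ?_ (recordsFactors_zero _))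
      rw [factor_shift, hz, length_factor, add_zero]
    · exact hD m hm

theorem evalListThen_eq {β : Type} (ms acc : List ℕ) (f : List ℕ → β) :
    evalListThen ms acc f = f (ms.reverse ++ acc) := by
  induction ms generalizing acc with
  | nil => rfl
  | cons m ms ih => rw [evalListThen, evalThen_eq, ih]; simp

theorem unavoided_tripleMask {t : List (Fin 2) × List (Fin 2) × List (Fin 2)}
    (h : t.1 ≠ [] ∧ t.2.1 ≠ [] ∧ t.2.2 ≠ []) : Unavoided (tripleMask t) := by
  intro w hw
  have key : ∀ l, (tripleMask t).testBit (wordCode l) = true → ∃ i ℓ, l = factor w i ℓ := by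
    intro l hl
    obtain ⟨i, ℓ, hi⟩ := hw _ hl
    rw [factorCode_eq] at hi
    exact ⟨i, ℓ, wordCode_injective hi⟩
  refine ⟨t.1, t.2.1, t.2.2, h.1, h.2.1, h.2.2, key _ ?_, key _ ?_, key _ ?_⟩ <;>
    simp [tripleMask]

theorem allDeadChain_smallTriples :
    evalListThen (smallTriples.map tripleMask) [] (allDeadChain excludedFactors) = true := by
  decide +kernel

/-- Every infinite binary word contains an occurrence of `C₃`. -/
theorem containsTriple (w : ℕ → Fin 2) : ContainsTriple w := by
  have h := allDeadChain_smallTriples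
  rw [evalListThen_eq] at h
  refine containsTriple_of_allDeadChain w (fun m hm => ?_) h
  simp only [List.append_nil, List.mem_reverse, List.mem_map] at hm
  obtain ⟨t, ht, rfl⟩ := hm
  have hne : ∀ t ∈ smallTriples, t.1 ≠ [] ∧ t.2.1 ≠ [] ∧ t.2.2 ≠ [] := by decide
  exact unavoided_tripleMask (hne t ht)

/-! ### Circles and desubstitution -/

/-- All factors of length `p + 1` of some infinite word `x` with period `p` are factors of `w`. -/
def ContainsCircle {α : Type*} (w : ℕ → α) (p : ℕ) : Prop :=
  ∃ x : ℕ → α, (∀ i, x (i + p) = x i) ∧ ∀ i, ∃ n, ∀ k ≤ p, w (n + k) = x (i + k)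

/-- Let `u` be the image of `v` under the `q`-uniform morphism `f`, where `f a s` is the letter at
place `s < q` of the image of `a`. Suppose that the letters of the image up to place `r` determine
`a`, and so do those from place `r` on, and that a window of length `L` in `u` determines its offset
modulo `q`. Then a circle of length at least `L` in `u` is the image of a circle in `v`. A window of
length `p + 1` starting at place `r` of a block ends at place `r` of a block, so that it determines
the letters of `v` at both ends. -/
theorem ContainsCircle.desubstitute {α β : Type*} {q r L p : ℕ} {f : α → ℕ → β} {v : ℕ → α}
    {u : ℕ → β} (hu : ∀ n, u n = f (v (n / q)) (n % q)) (hr : r < q)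
    (hpre : ∀ a b, (∀ s ≤ r, f a s = f b s) → a = b)
    (hsuf : ∀ a b, (∀ s < q, r ≤ s → f a s = f b s) → a = b)
    (hsync : ∀ m n, (∀ k < L, u (m + k) = u (n + k)) → m % q = n % q)
    (hp : 1 ≤ p) (hL : L ≤ p) (h : ContainsCircle u p) :
    ∃ m, 1 ≤ m ∧ p = q * m ∧ ContainsCircle v m := by
  obtain ⟨x, hx, hn⟩ := h
  choose n hn using hn
  have hq : 0 < q := by omega
  have hblock : ∀ a s, s < q → u (q * a + s) = f (v a) s := by
    intro a s hs
    rw [hu, Nat.mul_add_div hq, Nat.div_eq_of_lt hs, Nat.mul_add_mod, Nat.mod_eq_of_lt hs, add_zero]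
  -- consecutive windows overlap in `p` letters
  have hstep : ∀ i, n (i + 1) % q = (n i + 1) % q := by
    intro i
    refine hsync _ _ fun k hk => ?_
    rw [hn _ _ (by omega), add_assoc (n i), hn _ _ (by omega)]
    congr 1
    ring
  have hmod : ∀ i, n i % q = (n 0 + i) % q := by
    intro i
    induction i with
    | zero => rfl
    | succ i ih => rw [hstep, Nat.add_mod, ih, ← Nat.add_mod, add_assoc]
  have hdvd : q ∣ p := by
    have h₁ : n p % q = n 0 % q := by
      refine hsync _ _ fun k hk => ?_
      rw [hn _ _ (by omega), hn _ _ (by omega), add_comm p, hx, zero_add]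
    rw [hmod] at h₁
    exact (Nat.modEq_zero_iff_dvd).1 (Nat.ModEq.add_left_cancel' (n 0) h₁)
  obtain ⟨m, rfl⟩ := hdvd
  have hm : 1 ≤ m := Nat.pos_of_mul_pos_left hp
  -- shift `x` such that the blocks of `x` start at the multiples of `q`
  obtain ⟨d, hd⟩ : ∃ d, (n 0 + d) % q = 0 :=
    ⟨q * n 0 - n 0, by rw [Nat.add_sub_cancel' (Nat.le_mul_of_pos_left _ hq), Nat.mul_mod_right]⟩
  have hpos : ∀ j s, s < q → ∃ a, n (d + (q * j + s)) = q * a + s := by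
    intro j s hs
    refine ⟨n (d + (q * j + s)) / q, ?_⟩
    have : n (d + (q * j + s)) % q = s := by
      rw [hmod, show n 0 + (d + (q * j + s)) = (n 0 + d) + (q * j + s) by ring, Nat.add_mod, hd,
        zero_add, Nat.mod_mod, Nat.mul_add_mod, Nat.mod_eq_of_lt hs]
    conv_lhs => rw [← Nat.div_add_mod (n (d + (q * j + s))) q, this]
  choose! a ha using hpos
  have hread : ∀ j s, s < q → ∀ k ≤ q * m, u (q * a j s + s + k) = x (d + (q * j + s) + k) := by
    intro j s hs k hk
    rw [← ha j s hs]
    exact hn _ _ hk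
  have hqm : q ≤ q * m := Nat.le_mul_of_pos_right q hm
  -- the block of `x` at `q * j` is the image of a letter
  have hletter : ∀ j s, s < q → x (d + (q * j + s)) = f (v (a j r)) s := by
    intro j
    have hend : ∀ s < q, r ≤ s → x (d + (q * j + s)) = f (v (a j r)) s := by
      intro s hs hrs
      rw [← hblock _ _ hs]
      have := hread j r hr (s - r) (by omega)
      rw [show q * a j r + r + (s - r) = q * a j r + s by omega,
        show d + (q * j + r) + (s - r) = d + (q * j + s) by omega] at this
      exact this.symm
    have hall : ∀ s < q, x (d + (q * j + s)) = f (v (a j 0)) s := by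
      intro s hs
      rw [← hblock _ _ hs]
      have := hread j 0 hq s (by omega)
      rw [add_zero, add_zero, add_assoc] at this
      exact this.symm
    have heq : v (a j 0) = v (a j r) :=
      hsuf _ _ fun s hs hrs => by rw [← hall s hs, hend s hs hrs]
    intro s hs
    rw [hall s hs, heq]
  refine ⟨m, hm, rfl, fun j => v (a j r), fun j => ?_, fun j => ⟨a j r, fun k hk => ?_⟩⟩
  · refine hpre _ _ fun s hs => ?_
    rw [← hletter _ _ (by omega), ← hletter _ _ (by omega),
      show d + (q * (j + m) + s) = d + (q * j + s) + q * m by ring, hx]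
  · rcases Nat.eq_zero_or_pos k with rfl | hk0
    · rfl
    · have hread' : ∀ s < q, r ≤ q * k + s → q * k + s ≤ q * m + r →
          f (v (a j r + k)) s = f (v (a (j + k) r)) s := by
        intro s hs h₁ h₂
        rw [← hblock _ _ hs, ← hletter _ _ hs]
        have := hread j r hr (q * k + s - r) (by omega)
        rw [show q * a j r + r + (q * k + s - r) = q * a j r + q * k + s by omega, ← mul_add,
          show d + (q * j + r) + (q * k + s - r) = d + (q * j + q * k + s) by omega,
          ← mul_add] at this
        exact this
      have hqk : q ≤ q * k := Nat.le_mul_of_pos_right q hk0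
      have hkm : q * k ≤ q * m := Nat.mul_le_mul_left q hk
      exact hpre _ _ fun s hs => hread' s (by omega) (by omega) (by omega)

/-- The letter at place `k < 2 * q` of the image of the two-letter word `ab` under the `q`-uniform
morphism `f`. -/
def pairImage {α β : Type*} (q : ℕ) (f : α → ℕ → β) (a b : α) (k : ℕ) : β :=
  if k < q then f a k else f b (k - q)

theorem eq_pairImage {α β : Type*} {q : ℕ} {f : α → ℕ → β} {v : ℕ → α}
    {u : ℕ → β} (hu : ∀ n, u n = f (v (n / q)) (n % q)) (n k : ℕ) (hq : 0 < q)
    (hk : n % q + k < 2 * q) :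
    u (n + k) = pairImage q f (v (n / q)) (v (n / q + 1)) (n % q + k) := by
  have hn := Nat.div_add_mod n q
  have hlt := Nat.mod_lt n hq
  rw [hu, pairImage]
  generalize n / q = c at *
  generalize n % q = d at *
  subst hn
  split_ifs with h
  · rw [add_assoc, Nat.mul_add_div hq, Nat.div_eq_of_lt h, Nat.mul_add_mod, Nat.mod_eq_of_lt h,
      add_zero]
  · obtain ⟨e, he⟩ := Nat.exists_eq_add_of_le (not_lt.1 h)
    have hlt : e < q := by omega
    rw [add_assoc, he, ← add_assoc, ← Nat.mul_succ, Nat.mul_add_div hq, Nat.div_eq_of_lt hlt,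
      Nat.mul_add_mod, Nat.mod_eq_of_lt hlt, Nat.add_sub_cancel_left, add_zero]

/-- The word `x i, …, x (i + ℓ - 1)` read as a number in base `B`, lowest digit first. -/
def digitCode (B : ℕ) (x : ℕ → ℕ) : ℕ → ℕ → ℕ
  | _, 0 => 0
  | i, ℓ + 1 => x i + B * digitCode B x (i + 1) ℓ

theorem digitCode_congr {B : ℕ} {x y : ℕ → ℕ} {i j ℓ : ℕ} (h : ∀ k < ℓ, x (i + k) = y (j + k)) :
    digitCode B x i ℓ = digitCode B y j ℓ := by
  induction ℓ generalizing i j with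
  | zero => rfl
  | succ ℓ ih =>
    rw [digitCode, digitCode, ih fun k hk => ?_, show x i = y j from h 0 (by omega)]
    rw [add_assoc, add_assoc, add_comm 1 k]
    exact h (k + 1) (by omega)

theorem digitCode_succ (B : ℕ) (x : ℕ → ℕ) (i ℓ : ℕ) :
    digitCode B x i (ℓ + 1) = digitCode B x i ℓ + B ^ ℓ * x (i + ℓ) := by
  induction ℓ generalizing i with
  | zero => simp [digitCode]
  | succ ℓ ih =>
    rw [digitCode, ih, digitCode, pow_succ, show i + 1 + ℓ = i + (ℓ + 1) by ring]
    ring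

/-- The numbers `s + q * c`, where `c` codes the factor of length `ℓ` at place `s < q` in the image
of a word `ab` with `a ≠ b`. -/
def windowCodes {A B : ℕ} (q : ℕ) (f : Fin A → ℕ → Fin B) (ℓ : ℕ) : List ℕ :=
  (List.finRange A).flatMap fun a => (List.finRange A).flatMap fun b =>
    if a = b then [] else
      (List.range q).map fun s => s + q * digitCode B (fun k => (pairImage q f a b k).val) s ℓ

theorem mem_windowCodes {A B q : ℕ} {f : Fin A → ℕ → Fin B} {v : ℕ → Fin A} {u : ℕ → Fin B}
    (hu : ∀ n, u n = f (v (n / q)) (n % q)) (hv : ∀ n, v n ≠ v (n + 1)) (hq : 0 < q) {ℓ : ℕ}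
    (hℓ : ℓ ≤ q + 1) (n : ℕ) :
    n % q + q * digitCode B (fun k => (u k).val) n ℓ ∈ windowCodes q f ℓ := by
  have hn := Nat.mod_lt n hq
  simp only [windowCodes, List.mem_flatMap, List.mem_finRange, true_and]
  refine ⟨v (n / q), v (n / q + 1), ?_⟩
  rw [if_neg (hv _), List.mem_map]
  refine ⟨n % q, List.mem_range.2 hn, ?_⟩
  congr 2
  refine digitCode_congr fun k hk => ?_
  rw [eq_pairImage hu n k hq (by omega)]

/-- Equal windows have equal offsets, for `V` a list of window codes as in `windowCodes`. -/
def syncCheck (q : ℕ) (V : List ℕ) : Bool :=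
  evalListThen V [] fun V => V.all fun y => V.all fun z =>
    !(Nat.beq (y / q) (z / q)) || Nat.beq (y % q) (z % q)

theorem mod_eq_of_syncCheck {A B q L : ℕ} {f : Fin A → ℕ → Fin B} {v : ℕ → Fin A} {u : ℕ → Fin B}
    (hu : ∀ n, u n = f (v (n / q)) (n % q)) (hv : ∀ n, v n ≠ v (n + 1)) (hq : 0 < q)
    (hL : L ≤ q + 1) (h : syncCheck q (windowCodes q f L) = true) (m n : ℕ)
    (hmn : ∀ k < L, u (m + k) = u (n + k)) : m % q = n % q := by
  have hm := mem_windowCodes hu hv hq hL m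
  have hn := mem_windowCodes hu hv hq hL n
  rw [syncCheck, evalListThen_eq, List.append_nil, List.all_eq_true] at h
  have h := List.all_eq_true.1 (h _ (List.mem_reverse.2 hm)) _ (List.mem_reverse.2 hn)
  have e : digitCode B (fun k => (u k).val) m L = digitCode B (fun k => (u k).val) n L :=
    digitCode_congr fun k hk => by rw [hmn k hk]
  rw [e, Nat.add_mul_div_left _ _ hq, Nat.add_mul_div_left _ _ hq,
    Nat.div_eq_of_lt (Nat.mod_lt _ hq), Nat.div_eq_of_lt (Nat.mod_lt _ hq),
    Nat.add_mul_mod_self_left, Nat.add_mul_mod_self_left,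
    Nat.mod_mod, Nat.mod_mod] at h
  simpa using h

/-- For `c` the code of a window of length `p + 1` in a word with period `p`, the code of the window
starting one letter later. -/
def rotateCode (B p c : ℕ) : ℕ := c / B + B ^ p * (c / B % B)

theorem rotateCode_digitCode {B p : ℕ} (hp : 1 ≤ p) {x : ℕ → ℕ} (hB : ∀ i, x i < B)
    (hx : ∀ i, x (i + p) = x i) (i : ℕ) :
    rotateCode B p (digitCode B x i (p + 1)) = digitCode B x (i + 1) (p + 1) := by
  have hB0 : 0 < B := (Nat.zero_le _).trans_lt (hB 0)
  obtain ⟨p, rfl⟩ := Nat.exists_eq_add_of_le' hp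
  rw [digitCode_succ _ _ (i + 1), hx, rotateCode, digitCode, Nat.add_mul_div_left _ _ hB0,
    Nat.div_eq_of_lt (hB i), zero_add]
  congr 2
  rw [digitCode, Nat.add_mul_mod_self_left, Nat.mod_eq_of_lt (hB _)]

/-- One of the next `k` rotations of `c` is not in `V`. -/
def rotatesOutOf (B p : ℕ) (V : List ℕ) : ℕ → ℕ → Bool
  | 0, _ => false
  | k + 1, c => evalThen (rotateCode B p c) fun c => !V.any (Nat.beq c) || rotatesOutOf B p V k c

/-- Starting with any window of length `p + 1` whose first and last letters agree, some rotation
is not a window. -/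
def noCircleCheck (B q p : ℕ) (V : List ℕ) : Bool :=
  evalListThen (V.map (· / q)) [] fun V =>
    V.all fun c => !Nat.beq (c % B) (c / B ^ p) || rotatesOutOf B p V p c

theorem not_containsCircle_of_noCircleCheck {A B q p : ℕ} {f : Fin A → ℕ → Fin B} {v : ℕ → Fin A}
    {u : ℕ → Fin B} (hu : ∀ n, u n = f (v (n / q)) (n % q)) (hv : ∀ n, v n ≠ v (n + 1)) (hq : p ≤ q)
    (hp : 1 ≤ p) (h : noCircleCheck B q p (windowCodes q f (p + 1)) = true) :
    ¬ ContainsCircle u p := by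
  rintro ⟨x, hx, hn⟩
  have hq0 : 0 < q := by omega
  have hB : ∀ i, (x i).val < B := fun i => (x i).isLt
  have hB0 : 0 < B := (Nat.zero_le _).trans_lt (hB 0)
  rw [noCircleCheck, evalListThen_eq, List.append_nil] at h
  generalize hV : (List.map (· / q) (windowCodes q f (p + 1))).reverse = V at h
  have hmem : ∀ i, digitCode B (fun k => (x k).val) i (p + 1) ∈ V := by
    intro i
    obtain ⟨n, hn⟩ := hn i
    rw [← hV, List.mem_reverse, List.mem_map]
    refine ⟨_, mem_windowCodes hu hv hq0 (by omega) n, ?_⟩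
    rw [Nat.add_mul_div_left _ _ hq0, Nat.div_eq_of_lt (Nat.mod_lt _ hq0), zero_add]
    exact digitCode_congr fun k hk => by rw [hn k (by omega)]
  have hrotate : ∀ k i,
      rotatesOutOf B p V k (digitCode B (fun k => (x k).val) i (p + 1)) = false := by
    intro k
    induction k with
    | zero => exact fun _ => rfl
    | succ k ih =>
      intro i
      rw [rotatesOutOf, evalThen_eq, rotateCode_digitCode hp hB (fun i => by rw [hx]), ih,
        Bool.or_false, Bool.not_eq_false', List.any_eq_true]
      exact ⟨_, hmem _, Nat.beq_refl _⟩
  have hlt : ∀ i ℓ, digitCode B (fun k => (x k).val) i ℓ < B ^ ℓ := by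
    intro i ℓ
    induction ℓ with
    | zero => exact Nat.one_pos
    | succ ℓ ih =>
      rw [digitCode_succ, pow_succ]
      have := hB (i + ℓ)
      nlinarith [pow_pos hB0 ℓ]
  have h₁ := List.all_eq_true.1 h _ (hmem 0)
  rw [hrotate, Bool.or_false, digitCode_succ, Nat.add_mul_div_left _ _ (pow_pos hB0 p),
    Nat.div_eq_of_lt (hlt 0 p), ← digitCode_succ, digitCode, Nat.add_mul_mod_self_left,
    Nat.mod_eq_of_lt (hB 0), zero_add, zero_add, ← zero_add p, hx 0] at h₁
  simp at h₁

/-! ### Words without long circles -/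

/-- The `7`-uniform morphism `a ↦ a + 0130210` over `ℤ/4`. -/
def quatBlock (a : Fin 4) (s : ℕ) : Fin 4 := a + [0, 1, 3, 0, 2, 1, 0].getD s 0

/-- The morphism `0 ↦ 000`, `1 ↦ 101`, `2 ↦ 202`, `3 ↦ 112`. -/
def ternBlock (a : Fin 4) (s : ℕ) : Fin 3 :=
  ([[0, 0, 0], [1, 0, 1], [2, 0, 2], [1, 1, 2]].getD a.val []).getD s 0

/-- The morphism `0 ↦ 00001111`, `1 ↦ 00010111`, `2 ↦ 00101101`, `3 ↦ 00011011`. -/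
def binBlock (a : Fin 4) (s : ℕ) : Fin 2 :=
  ([[0, 0, 0, 0, 1, 1, 1, 1], [0, 0, 0, 1, 0, 1, 1, 1], [0, 0, 1, 0, 1, 1, 0, 1],
    [0, 0, 0, 1, 1, 0, 1, 1]].getD a.val []).getD s 0

/-- The fixed point, starting with `0`, of the morphism `quatBlock`. -/
def quatWord : ℕ → Fin 4
  | 0 => 0
  | n + 1 => quatBlock (quatWord ((n + 1) / 7)) ((n + 1) % 7)
termination_by n => n
decreasing_by omega

theorem quatWord_eq (n : ℕ) : quatWord n = quatBlock (quatWord (n / 7)) (n % 7) := by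
  cases n with
  | zero => simp [quatWord, quatBlock]
  | succ n => rw [quatWord]

theorem quatWord_ne_succ (n : ℕ) : quatWord n ≠ quatWord (n + 1) := by
  induction n using Nat.strong_induction_on with
  | _ n ih =>
    rw [quatWord_eq n, quatWord_eq (n + 1)]
    have hd := Nat.mod_lt n (show 0 < 7 by norm_num)
    by_cases h : n % 7 = 6
    · rw [h, show (n + 1) % 7 = 0 by omega, show (n + 1) / 7 = n / 7 + 1 by omega]
      exact fun h => ih (n / 7) (by omega) (by simpa [quatBlock] using h)
    · rw [show (n + 1) % 7 = n % 7 + 1 by omega, show (n + 1) / 7 = n / 7 by omega]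
      have : ∀ a : Fin 4, ∀ s < 6, quatBlock a s ≠ quatBlock a (s + 1) := by decide
      exact this _ _ (by omega)

theorem quatWord_not_containsCircle (p : ℕ) (hp : 1 ≤ p) : ¬ ContainsCircle quatWord p := by
  induction p using Nat.strong_induction_on with
  | _ p ih =>
    rcases lt_or_ge p 5 with h | h
    · refine not_containsCircle_of_noCircleCheck quatWord_eq quatWord_ne_succ (by omega) hp ?_
      clear ih
      interval_cases p <;> decide +kernel
    · intro hc
      obtain ⟨m, hm, hpm, hc⟩ := hc.desubstitute (r := 0) quatWord_eq (by norm_num)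
        (by decide) (by decide)
        (mod_eq_of_syncCheck quatWord_eq quatWord_ne_succ (L := 5) (by norm_num)
          (by norm_num) (by decide +kernel)) hp h
      exact ih m (by omega) hm hc

/-- The image of `quatWord` under `ternBlock`. -/
def ternWord (n : ℕ) : Fin 3 := ternBlock (quatWord (n / 3)) (n % 3)

/-- The image of `quatWord` under `binBlock`. -/
def binWord (n : ℕ) : Fin 2 := binBlock (quatWord (n / 8)) (n % 8)

theorem ternWord_not_containsCircle (p : ℕ) (hp : 3 ≤ p) : ¬ ContainsCircle ternWord p := by
  rcases lt_or_ge p 4 with h | h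
  · obtain rfl : p = 3 := by omega
    exact not_containsCircle_of_noCircleCheck (fun _ => rfl) quatWord_ne_succ le_rfl (by norm_num)
      (by decide +kernel)
  · intro hc
    obtain ⟨m, hm, -, hc⟩ := hc.desubstitute (r := 1) (fun _ => rfl) (by norm_num)
      (by decide) (by decide)
        (mod_eq_of_syncCheck (fun _ => rfl) quatWord_ne_succ (L := 4) (by norm_num)
        (by norm_num) (by decide +kernel)) (by omega) h
    exact quatWord_not_containsCircle m hm hc

theorem binWord_not_containsCircle (p : ℕ) (hp : 4 ≤ p) : ¬ ContainsCircle binWord p := by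
  rcases lt_or_ge p 7 with h | h
  · refine not_containsCircle_of_noCircleCheck (fun _ => rfl) quatWord_ne_succ (by omega)
      (by omega) ?_
    interval_cases p <;> decide +kernel
  · intro hc
    obtain ⟨m, hm, -, hc⟩ := hc.desubstitute (r := 4) (fun _ => rfl) (by norm_num)
      (by decide) (by decide)
        (mod_eq_of_syncCheck (fun _ => rfl) quatWord_ne_succ (L := 7) (by norm_num)
        (by norm_num) (by decide +kernel)) (by omega) h
    exact quatWord_not_containsCircle m hm hc

/-! ### Occurrences of circular formulas -/

theorem toList_map_ofList {β α : Type*} (h : FreeMonoid β →* FreeMonoid α) (l : List β) :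
    (h (FreeMonoid.ofList l)).toList = l.flatMap fun x => (h (FreeMonoid.of x)).toList := by
  induction l with
  | nil => simp
  | cons b l ih => simp [FreeMonoid.ofList_cons, ih]

/-- An occurrence of `C_t` yields a circle whose length is that of the image of `A₀ ⋯ A_{t-1}`. -/
theorem exists_containsCircle_of_isOccurrence {α : Type*} {t : ℕ} (ht : 1 ≤ t) {w : ℕ → α}
    {h : FreeMonoid ℕ →* FreeMonoid α} (hocc : IsOccurrence h (circularFormula t) w) :
    ∃ p, t ≤ p ∧ ContainsCircle w p := by
  obtain ⟨hne, hfac⟩ := hocc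
  set H : ℕ → List α := fun j => (h (FreeMonoid.of (j % t))).toList with hH
  have hHt : ∀ j, H (t + j) = H j := fun j => by simp [hH]
  have hHpos : ∀ j, 1 ≤ (H j).length := fun j => List.length_pos_of_ne_nil (hne (j % t))
  set P : ℕ → List α := fun n => (List.range n).flatMap H with hP
  have hPadd : ∀ m n, P (m + n) = P m ++ (List.range n).flatMap fun k => H (m + k) := fun m n => by
    simp [hP, List.range_add, List.flatMap_append, List.flatMap_map]
  have hPt : ∀ n, P (t + n) = P t ++ P n := fun n => by
    rw [hPadd]
    simp only [hHt, hP]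
  set ℓ : ℕ → ℕ := fun n => (P n).length with hℓ
  have hℓ0 : ℓ 0 = 0 := rfl
  have hℓsucc : ∀ n, ℓ n + 1 ≤ ℓ (n + 1) := fun n => by
    simp only [hℓ, hPadd n 1, List.length_append]
    have := hHpos n
    simpa using this
  have hℓle : ∀ n, n ≤ ℓ n := fun n => by
    induction n with
    | zero => exact Nat.zero_le _
    | succ n ih => have := hℓsucc n; omega
  have hℓt : ∀ n, ℓ (t + n) = ℓ t + ℓ n := fun n => by simp only [hℓ, hPt, List.length_append]
  -- the infinite concatenation of the words `H j`
  set x : ℕ → α := fun i => (P (i + 1)).getD i (w 0) with hx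
  have hxP : ∀ n i, i < ℓ n → x i = (P n).getD i (w 0) := by
    intro n i hi
    have hi' : i < ℓ (i + 1) := hℓle (i + 1)
    have hmono : ∀ m d, i < ℓ m → (P (m + d)).getD i (w 0) = (P m).getD i (w 0) := fun m d hm => by
      rw [hPadd, List.getD_append _ _ _ _ hm]
    rcases le_total n (i + 1) with hle | hle
    · obtain ⟨d, hd⟩ := Nat.exists_eq_add_of_le hle
      simp only [hx]
      rw [hd, hmono n d hi]
    · obtain ⟨d, rfl⟩ := Nat.exists_eq_add_of_le hle
      exact (hmono (i + 1) d hi').symm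
  refine ⟨ℓ t, hℓle t, x, fun i => ?_, fun i => ?_⟩
  · rw [hxP (i + 1) i (hℓle _), hxP (t + (i + 1)) (i + ℓ t) (by rw [hℓt]; have := hℓle (i + 1); omega),
      hPt, List.getD_append_right _ _ _ _ (Nat.le_add_left _ _), Nat.add_sub_cancel]
  -- the window at `i` lies in the image of the fragment starting with the block that contains `i`
  · obtain ⟨j, hj₁, hj₂⟩ : ∃ j, ℓ j ≤ i ∧ i < ℓ (j + 1) := by
      have hex : ∃ m, i < ℓ m := ⟨i + 1, hℓle _⟩
      obtain ⟨j, hj⟩ := Nat.exists_eq_succ_of_ne_zero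
        (fun h0 => by simpa [h0, hℓ0] using Nat.find_spec hex : Nat.find hex ≠ 0)
      refine ⟨j, not_lt.1 (Nat.find_min hex (by omega)), ?_⟩
      have := Nat.find_spec hex
      rwa [hj] at this
    obtain ⟨n, m, hn⟩ := isFactor_iff.1 (hfac _ (List.mem_map_of_mem
      (List.mem_range.2 (Nat.mod_lt j ht))))
    rw [toList_map_ofList, List.flatMap_map] at hn
    have hfrag : P (j + (t + 1)) = P j ++ factor w n m := by
      rw [hPadd, ← hn]
      simp [hH]
    have hm : ℓ t + ℓ (j + 1) = ℓ j + m := by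
      rw [← hℓt, show t + (j + 1) = j + (t + 1) by ring]
      simp only [hℓ, hfrag, List.length_append, length_factor]
    refine ⟨n + (i - ℓ j), fun k hk => ?_⟩
    have hlt : i + k - ℓ j < m := by omega
    rw [hxP (j + (t + 1)) (i + k) (by
        rw [show j + (t + 1) = t + (j + 1) by ring, hℓt]; omega), hfrag,
      List.getD_append_right _ _ _ _ (by show ℓ j ≤ _; omega)]
    change _ = (factor w n m).getD (i + k - ℓ j) (w 0)
    rw [List.getD_eq_getElem _ _ (by rwa [length_factor])]
    simp only [factor, List.getElem_map, List.getElem_range]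
    congr 1
    omega

theorem not_avoids_circularFormula_of_fin_one (t : ℕ) (w : ℕ → Fin 1) :
    ¬ Avoids w (circularFormula t) := by
  refine not_not_intro ⟨FreeMonoid.lift fun _ => FreeMonoid.of 0, fun x => ?_, fun p _ => ?_⟩
  · rw [FreeMonoid.lift_eval_of]
    exact FreeMonoid.of_ne_one _
  · exact ⟨0, List.ext_getElem (by simp; rfl) fun _ _ _ => Subsingleton.elim _ _⟩

theorem not_avoids_circularFormula_three (w : ℕ → Fin 2) : ¬ Avoids w (circularFormula 3) := by
  obtain ⟨a, b, c, ha, hb, hc, h₁, h₂, h₃⟩ := containsTriple w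
  refine not_not_intro ⟨FreeMonoid.lift fun i =>
    FreeMonoid.ofList (if i = 0 then a else if i = 1 then b else c), fun x => ?_, fun p hp => ?_⟩
  · rw [FreeMonoid.lift_eval_of]
    intro h
    have h := congrArg FreeMonoid.toList h
    simp only [FreeMonoid.toList_ofList, FreeMonoid.toList_one] at h
    split_ifs at h <;> contradiction
  · have hp : p = FreeMonoid.ofList [0, 1, 2, 0] ∨ p = FreeMonoid.ofList [1, 2, 0, 1] ∨
        p = FreeMonoid.ofList [2, 0, 1, 2] := by
      simpa [circularFormula, List.range_succ] using hp
    rw [isFactor_iff]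
    rcases hp with rfl | rfl | rfl <;> rw [toList_map_ofList]
    · simpa using h₁
    · simpa using h₂
    · simpa using h₃

theorem avoids_circularFormula {α : Type*} {w : ℕ → α} {t : ℕ} (ht : 1 ≤ t)
    (hw : ∀ p, t ≤ p → ¬ ContainsCircle w p) : Avoids w (circularFormula t) := by
  rintro ⟨h, hocc⟩
  obtain ⟨p, hp, hc⟩ := exists_containsCircle_of_isOccurrence ht hocc
  exact hw p hp hc

theorem avoidabilityIndex_eq {f : Formula} {n : ℕ} (h : ∃ w : ℕ → Fin n, Avoids w f)
    (hlt : ∀ m < n, ∀ w : ℕ → Fin m, ¬ Avoids w f) : avoidabilityIndex f = n := by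
  refine le_antisymm (sInf_le ⟨n, rfl, h⟩) (le_sInf ?_)
  rintro _ ⟨m, rfl, w, hw⟩
  exact Nat.cast_le.2 (not_lt.1 fun hm => hlt m hm w hw)

theorem theorem1 :
    avoidabilityIndex (circularFormula 3) = 3 ∧
      ∀ i : ℕ, 4 ≤ i → avoidabilityIndex (circularFormula i) = 2 := by
  refine ⟨avoidabilityIndex_eq (n := 3) ⟨ternWord, avoids_circularFormula (by norm_num)
    ternWord_not_containsCircle⟩ fun m hm w => ?_, fun i hi => avoidabilityIndex_eq (n := 2)
      ⟨binWord, avoids_circularFormula (by omega) fun p hp =>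
        binWord_not_containsCircle p (hi.trans hp)⟩ fun m hm w => ?_⟩
  · interval_cases m
    · exact (w 0).elim0
    · exact not_avoids_circularFormula_of_fin_one 3 w
    · exact not_avoids_circularFormula_three w
  · interval_cases m
    · exact (w 0).elim0
    · exact not_avoids_circularFormula_of_fin_one i w
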